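/- Let $G=(V,E)$ be a finite acyclic directed multigraph with unit-capacity channels, a single source node $s$ without incoming channels, and a set $T\not\ni s$ of sink nodes without outgoing channels; for $t\in T$ let $C_t$ be the minimum cut capacity between $s$ and $t$. Let $\mathcal F$ be a finite field and $\omega\ge 1$ an integer with $\omega\le C_t$ for all $t\in T$. An $n$-dimensional ($\mathcal F$-valued) linear network error correction code on $G$ is given by local encoding kernels $K_i=[k_{d,e}]_{d\in In(i),\,e\in Out(i)}$ over $\mathcal F$ at all nodes $i\notin T$, where $In(s)$ consists of $n$ imaginary message channels $d_1',\dots,d_n'$. Its extended global encoding kernels $\tilde f_e\in\mathcal F^{\,n+|E|}$, with coordinates indexed by $In(s)\cup E$, are determined by $\tilde f_{d_i'}=1_{d_i'}$ and $\tilde f_e=\sum_{d\in In(tail(e))}k_{d,e}\tilde f_d+1_e$ for $e\in E$, where $1_d$ denotes a standard unit vector. For $t\in T$ let $\tilde F_t=[\tilde f_e : e\in In(t)]=\begin{bmatrix}F_t\\ G_t\end{bmatrix}$, where $F_t$ has the rows indexed by $In(s)$ and $G_t$ those indexed by $E$. Put $\Phi(t)=\{X F_t: X\in\mathcal F^n\}$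 and, for an error pattern $\rho\subseteq E$, $\Delta(t,\rho)=\{Z G_t: Z\in\mathcal F^{E},\ Z_e=0 \text{ for } e\notin\rho\}$. The rank $rank_t(\rho)$ is the least $|\rho'|$ over the error patterns $\rho'$ such that $\Delta(t,\rho)\subseteq\Delta(t,\rho')$ for every linear network code over $\mathcal F$. A code is regular if $\dim\Phi(t)=n$ for all $t\in T$. A network MDS code of dimension $n\geq 1$ is a regular code such that, for all $t\in T$, $$\min\{rank_t(\rho):\ \dim(\Delta(t,\rho)\cap\Phi(t))>0\}=C_t-n+1 .$$ Let $R_t(\delta)$ be the set of error patterns $\rho$ with $|\rho|=rank_t(\rho)=\delta$. Theorem. If $$|\mathcal F|>\max_{0\le i\le\omega-1}\ \sum_{t\in T}|R_t(C_t-\omega+i)|,$$ then there is a family of variable-rate $\mathcal F$-valued network MDS codes of dimensions $1,2,\dots,\omega$: for each $n\in\{1,\dots,\omega\}$ there is an $n$-dimensional $\mathcal F$-valued network MDS code on $G$, and these $\omega$ codes have the same local encoding kernel at every internal node (every node of $V\setminus(\{s\}\cup T)$). -/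

import Mathlib

/-- A single source finite acyclic multicast network: `V` is the set of nodes, `E` is the set of
(unit capacity) channels, parallel channels being allowed.  The source has no incoming channels
and the sinks have no outgoing channels. -/
structure MulticastNetwork (V E : Type*) where
  /-- the node that a channel leaves -/
  tail : E → V
  /-- the node that a channel enters -/
  head : E → V
  /-- the source node -/
  source : V
  /-- the set of sink nodes -/
  sinks : Finset V
  source_notMem_sinks : source ∉ sinks
  head_ne_source : ∀ e, head e ≠ source
  tail_notMem_sinks : ∀ e, tail e ∉ sinks
  acyclic : ∀ v, ¬ Relation.TransGen (fun i j => ∃ e, tail e = i ∧ head e = j) v v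

namespace MulticastNetwork

variable {V E : Type*} (N : MulticastNetwork V E)

/-- The incoming channels of a node. -/
abbrev In (i : V) : Type _ := {e : E // N.head e = i}

/-- The outgoing channels of a node. -/
abbrev Out (i : V) : Type _ := {e : E // N.tail e = i}

/-- The nodes that are neither the source nor a sink. -/
def internalNodes : Set V := {i | i ≠ N.source ∧ i ∉ N.sinks}

/-- `A` is a cut between `i` and `j`: after the removal of the channels in `A`, no directed path
leads from `i` to `j`. -/
def IsCut (A : Finset E) (i j : V) : Prop :=
  ¬ Relation.ReflTransGen (fun u v => ∃ e, e ∉ A ∧ N.tail e = u ∧ N.head e = v) i j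

/-- The minimum cut capacity between two (distinct) nodes. -/
noncomputable def minCut (i j : V) : ℕ :=
  sInf {m | ∃ A : Finset E, N.IsCut A i j ∧ A.card = m}

/-- The minimum cut capacity `C_t` between the source and the node `t`. -/
noncomputable def capacity (t : V) : ℕ := N.minCut N.source t

/-- The channel `d` enters the node that the channel `e` leaves. -/
def Adjacent (d e : E) : Prop := N.head d = N.tail e

theorem adjacent_wellFounded [Finite E] : WellFounded N.Adjacent := by
  have hirr : ∀ e, ¬ Relation.TransGen N.Adjacent e e := fun e he =>
    N.acyclic (N.tail e) (he.lift N.tail fun d _ h => ⟨d, rfl, h⟩)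
  have : Std.Irrefl (Relation.TransGen N.Adjacent) := ⟨hirr⟩
  exact Subrelation.wf (fun h => Relation.TransGen.single h)
    (Finite.wellFounded_of_trans_of_irrefl (Relation.TransGen N.Adjacent))

end MulticastNetwork

/-- An `n`-dimensional `F`-valued linear network error correction code, in its local description:
the local encoding kernel at the source, whose rows are indexed by the `n` imaginary message
channels, and the local encoding kernels at the other nodes.  (At the source and at the sinks
`kernel` is an empty matrix, since the source has no incoming channels in `E` and a sink has no
outgoing channels.) -/
structure NetworkCode {V E : Type*} (N : MulticastNetwork V E) (F : Type*) (n : ℕ) where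
  /-- the local encoding kernel at the source -/
  sourceKernel : Matrix (Fin n) (N.Out N.source) F
  /-- the local encoding kernel at a node other than the source -/
  kernel : (i : V) → Matrix (N.In i) (N.Out i) F

namespace NetworkCode

variable {V E F : Type*} [Fintype E] [DecidableEq V] [DecidableEq E] [Field F]
  {N : MulticastNetwork V E} {n : ℕ} (C : NetworkCode N F n)

/-- The extended global encoding kernel `f̃_e` of the channel `e`, a column vector with entries
indexed by the `n` imaginary message channels and the channels in `E`. It is determined by
`f̃_e = ∑_{d ∈ In(tail(e))} k_{d,e} f̃_d + 1_e`, where `In(s)` consists of the imaginary message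
channels, whose kernels are standard unit vectors. -/
noncomputable def extKernel (e : E) : Fin n ⊕ E → F :=
  (if h : N.tail e = N.source then
    ∑ i : Fin n, C.sourceKernel i ⟨e, h⟩ • (Pi.single (Sum.inl i) 1 : Fin n ⊕ E → F)
  else
    ∑ d : N.In (N.tail e), C.kernel (N.tail e) d ⟨e, rfl⟩ • extKernel d.1)
  + Pi.single (Sum.inr e) 1
termination_by N.adjacent_wellFounded.wrap e
decreasing_by exact d.2

/-- The decoding matrix `F̃_t` at the node `t`, with columns `f̃_e` for `e ∈ In(t)`. -/
noncomputable def decodingMatrix (t : V) : Matrix (Fin n ⊕ E) (N.In t) F :=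
  Matrix.of fun d e => C.extKernel e.1 d

/-- The upper block `F_t` of the decoding matrix: rows of the imaginary message channels. -/
noncomputable def messageMatrix (t : V) : Matrix (Fin n) (N.In t) F :=
  (C.decodingMatrix t).submatrix Sum.inl id

/-- The lower block `G_t` of the decoding matrix: rows of the channels in `E`. -/
noncomputable def errorMatrix (t : V) : Matrix E (N.In t) F :=
  (C.decodingMatrix t).submatrix Sum.inr id

/-- The message space `Φ(t)`, the set of all `X · F_t`. -/
noncomputable def messageSpace (t : V) : Submodule F (N.In t → F) :=
  LinearMap.range (C.messageMatrix t).vecMulLinear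

/-- The error space `Δ(t,p)` of the error pattern `p`, the set of all `Z · G_t` with `Z` matching
`p`, that is, with `Z e = 0` for `e ∉ p`. -/
noncomputable def errorSpace (t : V) (p : Finset E) : Submodule F (N.In t → F) :=
  (Submodule.pi {e : E | e ∉ p} fun _ => (⊥ : Submodule F F)).map (C.errorMatrix t).vecMulLinear

/-- A code is regular if its message space has full dimension at every sink. -/
def IsRegular : Prop := ∀ t ∈ N.sinks, Module.finrank F (C.messageSpace t) = n

theorem mem_messageSpace {t : V} {y : N.In t → F} :
    y ∈ C.messageSpace t ↔ ∃ X : Fin n → F, Matrix.vecMul X (C.messageMatrix t) = y := by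
  simp [messageSpace, LinearMap.mem_range]

theorem mem_errorSpace {t : V} {p : Finset E} {y : N.In t → F} :
    y ∈ C.errorSpace t p ↔
      ∃ Z : E → F, (∀ e, e ∉ p → Z e = 0) ∧ Matrix.vecMul Z (C.errorMatrix t) = y := by
  simp [errorSpace, Submodule.mem_map, Submodule.mem_pi]

end NetworkCode

namespace MulticastNetwork

variable {V E : Type*} [Fintype E] [DecidableEq V] [DecidableEq E] (N : MulticastNetwork V E)
  (F : Type*) [Field F]

/-- The error pattern `p` is dominated by `q` with respect to `t`: for any linear network code
over `F`, the error space of `p` is contained in that of `q`. -/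
def Dominated (t : V) (p q : Finset E) : Prop :=
  ∀ (n : ℕ) (C : NetworkCode N F n), C.errorSpace t p ≤ C.errorSpace t q

/-- The rank of the error pattern `p` with respect to `t`: the least cardinality of an error
pattern that dominates `p`. -/
noncomputable def patternRank (t : V) (p : Finset E) : ℕ :=
  sInf {m | ∃ q : Finset E, N.Dominated F t p q ∧ q.card = m}

/-- The set `R_t(δ)` of the error patterns `p` with `|p| = rank_t(p) = δ`. -/
def rankPatterns (t : V) (δ : ℕ) : Set (Finset E) :=
  {p | p.card = δ ∧ N.patternRank F t p = δ}

end MulticastNetwork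

namespace NetworkCode

variable {V E F : Type*} [Fintype E] [DecidableEq V] [DecidableEq E] [Field F]
  {N : MulticastNetwork V E} {n : ℕ} (C : NetworkCode N F n)

/-- The minimum distance of a (regular) code at the sink `t`. For a regular code of positive
dimension the set is nonempty. -/
noncomputable def minDist (t : V) : ℕ :=
  sInf {m | ∃ p : Finset E,
    0 < Module.finrank F ↥(C.errorSpace t p ⊓ C.messageSpace t) ∧ N.patternRank F t p = m}

/-- A network MDS code: a regular code that attains the refined Singleton bound
`d_min = C_t - n + 1` at every sink `t`. -/
def IsMDS : Prop :=
  C.IsRegular ∧ ∀ t ∈ N.sinks, (C.minDist t : ℤ) = (N.capacity t : ℤ) - (n : ℤ) + 1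

end NetworkCode

/-!
The coefficients of a code and of its network form one matrix `K` on `Fin n ⊕ E`, and a code tells
the messages and the errors in `p` apart at a sink exactly when the rows of `(1 - K)⁻¹` on
`Fin n ⊕ p`, restricted to the channels entering the sink, are linearly independent. For a single
sink and a single independent pattern (one whose rank is its size), Menger's theorem yields disjoint
paths and hence such a `K`. Changing one entry of `K` is a rank-one perturbation, which destroys
the independence of the rows for at most one value of the entry, so over a large enough field the
solutions for several sinks and patterns can be merged entry by entry.

Doing this in dimension `ω` for the independent patterns of size `C_t - ω` gives one code `C`. An
independent pattern of size `C_t - n` contains one of size `C_t - ω`, so the messages that it can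
mask under `C` form a space of dimension at most `ω - n`. Hence a single `n`-dimensional message
space avoids all of them, and restricting `C` to it alters only the kernel at the source.
-/

open scoped Matrix

theorem exists_forall_notMem_of_subsingleton {J K : Type*} (s : Finset J)
    (hs : (s.card : ℕ∞) < ENat.card K) (bad : J → Set K) (hbad : ∀ j ∈ s, (bad j).Subsingleton) :
    ∃ a, ∀ j ∈ s, a ∉ bad j := by
  by_contra! hcover
  choose j hj hmem using hcover
  have hinj : Function.Injective fun a => (⟨j a, hj a⟩ : s) := fun a b hab => by
    have hjab : j a = j b := Subtype.ext_iff.1 hab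
    exact hbad (j a) (hj a) (hmem a) (hjab ▸ hmem b)
  exact hs.not_ge (by simpa using ENat.card_le_card_of_injective hinj)

/-- Starting from solutions of the single conditions, the coordinates are equalized one at a time:
each condition forbids at most one value of the coordinate at hand. -/
theorem exists_forall_of_subsingleton_not {J ι K : Type*} [Finite ι] [DecidableEq ι] (s : Finset J)
    (hs : (s.card : ℕ∞) < ENat.card K) (P : J → (ι → K) → Prop) (hP : ∀ j ∈ s, ∃ x, P j x)
    (hline : ∀ j ∈ s, ∀ x, P j x → ∀ i, {a | ¬ P j (Function.update x i a)}.Subsingleton) :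
    ∃ x, ∀ j ∈ s, P j x := by
  have := Fintype.ofFinite ι
  have : Nonempty K := (ENat.card_pos_iff_nonempty K).1 (hs.trans_le' zero_le)
  suffices h : ∀ u : Finset ι, ∃ x : ι → K, ∀ j ∈ s, ∃ y, (∀ i ∈ u, y i = x i) ∧ P j y by
    obtain ⟨x, hx⟩ := h Finset.univ
    refine ⟨x, fun j hj => ?_⟩
    obtain ⟨y, hyx, hy⟩ := hx j hj
    rwa [show y = x from funext fun i => hyx i (Finset.mem_univ i)] at hy
  intro u
  induction u using Finset.induction_on with
  | empty => exact ⟨fun _ => Classical.arbitrary K, fun j hj => by simpa using hP j hj⟩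
  | insert i u hi ih =>
    obtain ⟨x, hx⟩ := ih
    choose! y hyx hy using hx
    obtain ⟨a, ha⟩ := exists_forall_notMem_of_subsingleton s hs _
      fun j hj => hline j hj (y j) (hy j hj) i
    refine ⟨Function.update x i a,
      fun j hj => ⟨Function.update (y j) i a, fun k hk => ?_, not_not.1 (ha j hj)⟩⟩
    obtain rfl | hki := eq_or_ne k i
    · simp only [Function.update_self]
    · rw [Function.update_of_ne hki, Function.update_of_ne hki]
      exact hyx j hj k (Finset.mem_of_mem_insert_of_ne hk hki)

section Submodule

variable {J K M : Type*} [DivisionRing K] [AddCommGroup M] [Module K M]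

theorem exists_forall_notMem_of_ne_top (s : Finset J) (hs : (s.card : ℕ∞) < ENat.card K)
    (B : J → Submodule K M) (hB : ∀ j ∈ s, B j ≠ ⊤) : ∃ v, ∀ j ∈ s, v ∉ B j := by
  classical
  induction s using Finset.induction_on with
  | empty => exact ⟨0, by simp⟩
  | insert i s _ ih =>
    have hs' : (s.card : ℕ∞) < ENat.card K :=
      hs.trans_le' (by exact_mod_cast Finset.card_le_card (Finset.subset_insert i s))
    obtain ⟨w, hw⟩ := ih hs' fun j hj => hB j (Finset.mem_insert_of_mem hj)
    by_cases hwi : w ∈ B i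
    · obtain ⟨u, hu⟩ := SetLike.exists_not_mem_of_ne_top (B i) (hB i (Finset.mem_insert_self i s))
      obtain ⟨a, ha⟩ := exists_forall_notMem_of_subsingleton s hs' (fun j => {a | u + a • w ∈ B j})
        fun j hj a ha b hb => by
          by_contra hab
          have hdiff : (a - b) • w ∈ B j := by
            simpa [sub_smul] using (B j).sub_mem ha hb
          exact hw j hj (((B j).smul_mem_iff (sub_ne_zero.2 hab)).1 hdiff)
      refine ⟨u + a • w, (Finset.forall_mem_insert ..).2 ⟨fun h => hu ?_, ha⟩⟩
      exact (Submodule.add_mem_iff_left _ ((B i).smul_mem a hwi)).1 h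
    · exact ⟨w, (Finset.forall_mem_insert ..).2 ⟨hwi, hw⟩⟩

theorem exists_forall_linearIndependent_mkQ (s : Finset J) (hs : (s.card : ℕ∞) < ENat.card K)
    (B : J → Submodule K M) (n : ℕ) (hB : ∀ j ∈ s, n ≤ Module.finrank K (M ⧸ B j)) :
    ∃ v : Fin n → M, ∀ j ∈ s, LinearIndependent K ((B j).mkQ ∘ v) := by
  induction n with
  | zero => exact ⟨Fin.elim0, fun j _ => linearIndependent_empty_type⟩
  | succ n ih =>
    obtain ⟨v, hv⟩ := ih fun j hj => (Nat.le_succ n).trans (hB j hj)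
    obtain ⟨w, hw⟩ := exists_forall_notMem_of_ne_top s hs
      (fun j => (Submodule.span K (Set.range ((B j).mkQ ∘ v))).comap (B j).mkQ) fun j hj htop => by
        have hspan : Submodule.span K (Set.range ((B j).mkQ ∘ v)) = ⊤ :=
          Submodule.comap_injective_of_surjective (B j).mkQ_surjective (by simpa using htop)
        have hle := finrank_range_le_card (R := K) ((B j).mkQ ∘ v)
        rw [Set.finrank, hspan, finrank_top, Fintype.card_fin] at hle
        exact absurd (hB j hj) (by omega)
    refine ⟨Fin.cons w v, fun j hj => ?_⟩
    rw [Fin.comp_cons, linearIndependent_finCons]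
    exact ⟨hv j hj, hw j hj⟩

end Submodule

section Linkage

variable {X R J : Type*} {r : X → X → Prop}

theorem wellFounded_flip_of_acyclic [Finite X] (hr : ∀ x, ¬ Relation.TransGen r x x) :
    WellFounded (flip r) := by
  have : Std.Irrefl (Relation.TransGen (flip r)) :=
    ⟨fun x hx => hr x (Relation.transGen_swap.1 hx)⟩
  exact Subrelation.wf (fun h => Relation.TransGen.single h)
    (Finite.wellFounded_of_trans_of_irrefl (Relation.TransGen (flip r)))

/-- Vertex separation in the directed graph with edge relation `r`: every path from `A` to `B`
meets `Q`, possibly at one of its ends. -/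
def Separates (r : X → X → Prop) (A B Q : Set X) : Prop :=
  ∀ a ∈ A, a ∉ Q → ∀ b ∈ B, ¬ Relation.ReflTransGen (fun x y => r x y ∧ y ∉ Q) a b

theorem separates_sdiff_of_disjoint {A B S T : Set X} (hSB : Disjoint S B)
    (hT : ∀ x ∈ S, ∀ y, r x y → y ∈ T) : Separates r A B ((A ∪ T) \ S) := by
  intro a ha haQ b hb hpath
  refine Set.disjoint_left.1 hSB ?_ hb
  clear hb
  induction hpath with
  | refl => exact by_contra fun h => haQ ⟨Or.inl ha, h⟩
  | tail _ hstep ih => exact by_contra fun h => hstep.2 ⟨Or.inr (hT _ ih _ hstep.1), h⟩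

/-- Menger's theorem in matching form: the iterates of `f` trace disjoint paths from `A` to `B`, and
the fixed points of `f` lie on none of them. -/
theorem exists_linkage [Finite X] {A : Finset X} {B : Set X}
    (hsep : ∀ Q : Finset X, Separates r A B Q → A.card ≤ Q.card) :
    ∃ f : {x // x ∉ B} → X, Function.Injective f ∧ ∀ x, f x ∉ A ∧ (f x = x ∨ r x (f x)) := by
  classical
  have := Fintype.ofFinite X
  refine (Fintype.all_card_le_filter_rel_iff_exists_injective
    fun (x : {x // x ∉ B}) y => y ∉ A ∧ (y = x ∨ r x y)).1 fun S => ?_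
  let S' : Finset X := S.map (Function.Embedding.subtype _)
  let T : Finset X := {y | ∃ x ∈ S, y = x ∨ r x y}
  have hST : S' ⊆ T := fun x hx => by
    obtain ⟨z, hz, rfl⟩ := Finset.mem_map.1 hx
    exact Finset.mem_filter.2 ⟨Finset.mem_univ _, z, hz, Or.inl rfl⟩
  have hcard : A.card ≤ ((A ∪ T) \ S').card := by
    refine hsep _ ?_
    rw [Finset.coe_sdiff, Finset.coe_union]
    refine separates_sdiff_of_disjoint (Set.disjoint_left.2 fun x hx => ?_) fun x hx y hxy => ?_
    · obtain ⟨z, -, rfl⟩ := Finset.mem_map.1 hx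
      exact z.2
    · obtain ⟨z, hz, rfl⟩ := Finset.mem_map.1 hx
      exact Finset.mem_filter.2 ⟨Finset.mem_univ _, z, hz, Or.inr hxy⟩
  have hneighbours : ({y | ∃ x ∈ S, y ∉ A ∧ (y = x ∨ r x y)} : Finset X) = T \ A := by
    ext y
    simp only [T, Finset.mem_filter, Finset.mem_univ, true_and, Finset.mem_sdiff]
    grind
  rw [hneighbours, ← S.card_map (Function.Embedding.subtype _)]
  have h₁ := Finset.card_sdiff_add_card_eq_card (hST.trans (Finset.subset_union_right (s₁ := A)))
  have h₂ := Finset.card_sdiff_add_card T A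
  rw [Finset.union_comm] at h₂
  change S'.card ≤ _
  omega

/-- Observability of the linear system with transition matrix `K`: a signal that is injected only
at the points of `A`, that is, whose defect `y - y K` is supported in `A`, is determined by its
values on `B`. -/
def Observable [Fintype X] [DecidableEq X] [Ring R] (K : Matrix X X R) (A B : Set X) : Prop :=
  ∀ y : X → R, (∀ x ∉ A, (y ᵥ* (1 - K)) x = 0) → (∀ x ∈ B, y x = 0) → y = 0

theorem exists_observable_of_linkage [Fintype X] [DecidableEq X] [Ring R]
    (hr : ∀ x, ¬ Relation.TransGen r x x) {A B : Set X} {f : {x // x ∉ B} → X}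
    (hf : Function.Injective f) (hfA : ∀ x, f x ∉ A ∧ (f x = x ∨ r x (f x))) :
    ∃ K : Matrix X X R, (∀ x y, ¬ r x y → K x y = 0) ∧ Observable K A B := by
  classical
  let K : Matrix X X R := Matrix.of fun x y =>
    if ∃ h : x ∉ B, f ⟨x, h⟩ = y ∧ r x y then 1 else 0
  refine ⟨K, fun x y hxy => if_neg fun ⟨_, _, h⟩ => hxy h, fun y hyA hyB => funext fun x => ?_⟩
  induction x using (wellFounded_flip_of_acyclic hr).induction with
  | _ x ih =>
  by_cases hx : x ∈ B
  · exact hyB x hx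
  have hcol : ∀ z, K z (f ⟨x, hx⟩) = if z = x ∧ r x (f ⟨x, hx⟩) then 1 else 0 := fun z => by
    refine if_congr ⟨?_, ?_⟩ rfl rfl
    · rintro ⟨hz, hfz, hstep⟩
      obtain rfl : z = x := congrArg Subtype.val (hf hfz)
      exact ⟨rfl, hstep⟩
    · rintro ⟨rfl, hstep⟩
      exact ⟨hx, rfl, hstep⟩
  have heq := hyA _ (hfA ⟨x, hx⟩).1
  rw [Matrix.vecMul_sub, Matrix.vecMul_one, Pi.sub_apply, sub_eq_zero] at heq
  simp only [Matrix.vecMul, dotProduct, hcol] at heq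
  obtain hstay | hstep := (hfA ⟨x, hx⟩).2
  · have hloop : ¬ r x x := fun h => hr x (.single h)
    simpa [hstay, hloop] using heq
  · simpa [hstep, ih _ hstep, eq_comm] using heq

/-- If two perturbations of the entry fail, a combination of the two unobserved signals in which the
perturbations cancel is an unobserved signal of `K`. -/
theorem Observable.subsingleton_not_add_single [Fintype X] [DecidableEq X] [CommRing R]
    [IsDomain R] {K : Matrix X X R} {A B : Set X} (hK : Observable K A B) (i j : X) :
    {a | ¬ Observable (K + Matrix.single i j a) A B}.Subsingleton := by
  have unobserved : ∀ a, ¬ Observable (K + Matrix.single i j a) A B → ∃ u : X → R, u ≠ 0 ∧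
      (∀ x ∉ A, (u ᵥ* (1 - K)) x = if x = j then a * u i else 0) ∧ ∀ x ∈ B, u x = 0 := by
    intro a ha
    simp only [Observable, not_forall] at ha
    obtain ⟨u, huA, huB, hu⟩ := ha
    refine ⟨u, hu, fun x hx => ?_, huB⟩
    have hx' := huA x hx
    rw [sub_add_eq_sub_sub, Matrix.vecMul_sub, Pi.sub_apply, sub_eq_zero] at hx'
    rw [hx']
    simp [Matrix.vecMul, dotProduct, Matrix.single_apply, ite_and, mul_comm, eq_comm]
  intro a ha b hb
  obtain ⟨u, hu, huA, huB⟩ := unobserved a ha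
  obtain ⟨w, hw, hwA, hwB⟩ := unobserved b hb
  have hcomb : (b * w i) • u - (a * u i) • w = 0 := by
    refine hK _ (fun x hx => ?_) fun x hx => ?_
    · simp only [Matrix.sub_vecMul, Matrix.smul_vecMul, Pi.sub_apply, Pi.smul_apply, huA x hx,
        hwA x hx, smul_eq_mul]
      split_ifs <;> ring
    · simp [huB x hx, hwB x hx]
  have hui : u i ≠ 0 := fun h => hu (hK u (fun x hx => by simpa [h] using huA x hx) huB)
  have hwi : w i ≠ 0 := fun h => hw (hK w (fun x hx => by simpa [h] using hwA x hx) hwB)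
  have hi := congrFun hcomb i
  simp only [Pi.sub_apply, Pi.smul_apply, smul_eq_mul, Pi.zero_apply] at hi
  have : (a - b) * (u i * w i) = 0 := by linear_combination -hi
  exact sub_eq_zero.1 ((mul_eq_zero.1 this).resolve_right (mul_ne_zero hui hwi))

theorem exists_forall_observable [Fintype X] [DecidableEq X] [CommRing R] [IsDomain R]
    (hr : ∀ x, ¬ Relation.TransGen r x x) (s : Finset J) (hs : (s.card : ℕ∞) < ENat.card R)
    (A : J → Finset X) (B : J → Set X)
    (hsep : ∀ j ∈ s, ∀ Q : Finset X, Separates r (A j) (B j) Q → (A j).card ≤ Q.card) :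
    ∃ K : Matrix X X R, (∀ x y, ¬ r x y → K x y = 0) ∧ ∀ j ∈ s, Observable K (A j) (B j) := by
  classical
  let masked : (X × X → R) → Matrix X X R := fun k =>
    Matrix.of fun x y => if r x y then k (x, y) else 0
  have hupdate : ∀ k x y a, masked (Function.update k (x, y) a) =
      if r x y then masked k + Matrix.single x y (a - k (x, y)) else masked k := by
    intro k x y a
    ext x' y'
    split_ifs <;>
      simp only [masked, Matrix.of_apply, Matrix.add_apply, Matrix.single_apply,
        Function.update_apply, Prod.mk.injEq] <;> grind
  suffices h : ∃ k, ∀ j ∈ s, Observable (masked k) (A j) (B j) by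
    obtain ⟨k, hk⟩ := h
    exact ⟨masked k, fun x y hxy => if_neg hxy, hk⟩
  refine exists_forall_of_subsingleton_not s hs (fun j k => Observable (masked k) (A j) (B j))
    (fun j hj => ?_) fun j _ k hk ⟨x, y⟩ => ?_
  · obtain ⟨f, hf, hfA⟩ := exists_linkage (hsep j hj)
    obtain ⟨K, hKr, hK⟩ := exists_observable_of_linkage (R := R) hr hf hfA
    refine ⟨fun z => K z.1 z.2, ?_⟩
    convert hK using 1
    ext x y
    by_cases hxy : r x y
    · simp [masked, hxy]
    · simp [masked, hxy, hKr]
  · by_cases hxy : r x y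
    · simp only [hupdate, if_pos hxy]
      exact (hk.subsingleton_not_add_single x y).preimage (sub_left_injective (b := k (x, y)))
    · simp [hupdate, hxy, hk]

end Linkage

namespace MulticastNetwork

variable {V E : Type*} (N : MulticastNetwork V E)

theorem adjacent_acyclic (e : E) : ¬ Relation.TransGen N.Adjacent e e := fun he =>
  N.acyclic (N.tail e) (he.lift N.tail fun d _ h => ⟨d, rfl, h⟩)

/-- The node that an extended channel enters, the imaginary message channels entering the source. -/
def extHead (n : ℕ) : Fin n ⊕ E → V := Sum.elim (fun _ => N.source) N.head

/-- The extension of `Adjacent` to the imaginary message channels, which no channel feeds. -/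
def Feeds (n : ℕ) (d e : Fin n ⊕ E) : Prop := ∃ c, e = Sum.inr c ∧ N.extHead n d = N.tail c

theorem feeds_acyclic (n : ℕ) (d : Fin n ⊕ E) : ¬ Relation.TransGen (N.Feeds n) d d := by
  refine fun h => N.acyclic (N.extHead n d) (h.lift (N.extHead n) ?_)
  rintro d _ ⟨c, rfl, hc⟩
  exact ⟨c, hc.symm, rfl⟩

variable {N} {n : ℕ} {t : V}

theorem IsCut.head {Q : Finset E} {e : E} (h : N.IsCut Q (N.tail e) t) (he : e ∉ Q) :
    N.IsCut Q (N.head e) t :=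
  fun hpath => h (.head ⟨e, he, rfl, rfl⟩ hpath)

theorem isCut_toRight_of_separates {A : Set (Fin n ⊕ E)} {Q : Finset (Fin n ⊕ E)}
    (hQ : Separates (N.Feeds n) A {e | N.extHead n e = t} Q) {a : Fin n ⊕ E} (ha : a ∈ A)
    (haQ : a ∉ Q) : N.IsCut Q.toRight (N.extHead n a) t := by
  suffices hlift : ∀ v, Relation.ReflTransGen
      (fun u v => ∃ e, e ∉ Q.toRight ∧ N.tail e = u ∧ N.head e = v) (N.extHead n a) v →
      ∃ b, N.extHead n b = v ∧ Relation.ReflTransGen (fun d e => N.Feeds n d e ∧ e ∉ Q) a b by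
    intro hpath
    obtain ⟨b, hb, hab⟩ := hlift t hpath
    exact hQ a ha haQ b hb hab
  intro v hv
  induction hv with
  | refl => exact ⟨a, rfl, .refl⟩
  | tail _ hstep ih =>
    obtain ⟨b, hb, hab⟩ := ih
    obtain ⟨e, heQ, rfl, rfl⟩ := hstep
    exact ⟨Sum.inr e, rfl, hab.tail ⟨⟨e, rfl, hb⟩, fun h => heQ (Finset.mem_toRight.2 h)⟩⟩

theorem capacity_le_card {Q : Finset E} (hQ : N.IsCut Q N.source t) : N.capacity t ≤ Q.card :=
  Nat.sInf_le ⟨Q, hQ, rfl⟩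

theorem exists_isCut_card_eq_capacity [Finite E] (ht : N.source ≠ t) :
    ∃ Q : Finset E, N.IsCut Q N.source t ∧ Q.card = N.capacity t := by
  have := Fintype.ofFinite E
  have huniv : N.IsCut Finset.univ N.source t := fun hpath => by
    obtain rfl | ⟨v, ⟨e, he, -⟩, -⟩ := hpath.cases_head
    · exact ht rfl
    · exact he (Finset.mem_univ e)
  exact Nat.sInf_mem (s := {m | ∃ Q : Finset E, N.IsCut Q N.source t ∧ Q.card = m})
    ⟨_, Finset.univ, huniv, rfl⟩

end MulticastNetwork

namespace NetworkCode

variable {V E F : Type*} [DecidableEq V] [Field F] {N : MulticastNetwork V E} {n : ℕ}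
  (C : NetworkCode N F n)

/-- The local encoding kernel at the source as a matrix with a column for every channel: zero in the
columns of the channels that do not leave the source. -/
def sourceMatrix : Matrix (Fin n) E F :=
  Matrix.of fun i e => if h : N.tail e = N.source then C.sourceKernel i ⟨e, h⟩ else 0

/-- The local encoding kernels at the other nodes as one matrix, the entry at `(d, e)` being zero
unless `d` enters the node that `e` leaves. -/
def channelMatrix : Matrix E E F :=
  Matrix.of fun d e =>
    if h : N.head d = N.tail e then C.kernel (N.tail e) ⟨d, h⟩ ⟨e, rfl⟩ else 0

/-- All the local encoding kernels as one matrix on the extended channels. -/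
def transition : Matrix (Fin n ⊕ E) (Fin n ⊕ E) F :=
  Matrix.fromBlocks 0 C.sourceMatrix 0 C.channelMatrix

theorem exists_transition_eq (K : Matrix (Fin n ⊕ E) (Fin n ⊕ E) F)
    (hK : ∀ d e, ¬ N.Feeds n d e → K d e = 0) : ∃ C : NetworkCode N F n, C.transition = K := by
  refine ⟨⟨Matrix.of fun i e => K (Sum.inl i) (Sum.inr e), fun _ =>
    Matrix.of fun d e => K (Sum.inr d) (Sum.inr e)⟩, ?_⟩
  have hsource : ∀ d i, K d (Sum.inl i) = 0 := fun d i => hK _ _ fun ⟨_, h, _⟩ => nomatch h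
  have hfeeds : ∀ d e, N.extHead n d ≠ N.tail e → K d (Sum.inr e) = 0 := fun d e hde =>
    hK _ _ fun ⟨_, hec, h⟩ => hde (Sum.inr_injective hec ▸ h)
  ext (i | d) (j | e)
  · exact (hsource _ _).symm
  · by_cases h : N.tail e = N.source
    · simp [transition, sourceMatrix, h]
    · simpa [transition, sourceMatrix, h] using (hfeeds (Sum.inl i) e (Ne.symm h)).symm
  · exact (hsource _ _).symm
  · by_cases h : N.head d = N.tail e
    · simp [transition, channelMatrix, h]
    · simpa [transition, channelMatrix, h] using (hfeeds (Sum.inr d) e h).symm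

variable [Fintype E] [DecidableEq E]

theorem extKernel_eq_add_sum (e : E) :
    C.extKernel e = ∑ i, C.sourceMatrix i e • Pi.single (Sum.inl i) 1 +
      ∑ d, C.channelMatrix d e • C.extKernel d + Pi.single (Sum.inr e) 1 := by
  rw [extKernel]
  congr 1
  by_cases h : N.tail e = N.source
  · simp [sourceMatrix, channelMatrix, h, N.head_ne_source]
  · simp only [sourceMatrix, channelMatrix, h, Matrix.of_apply, dite_false, zero_smul,
      Finset.sum_const_zero, zero_add]
    refine Fintype.sum_of_injective Subtype.val Subtype.val_injective _ _ (fun d hd => ?_)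
      fun d => ?_
    · rw [dif_neg fun hde => hd ⟨⟨d, hde⟩, rfl⟩, zero_smul]
    · rw [dif_pos d.2]

/-- Koetter and Médard's transfer matrix: row `d` is the response of all the channels to a unit
error in the channel `d`. -/
noncomputable def transfer : Matrix E E F := (1 - C.channelMatrix)⁻¹

theorem of_extKernel_mul_one_sub_channelMatrix :
    Matrix.of (fun d e => C.extKernel e (Sum.inr d)) * (1 - C.channelMatrix) = 1 := by
  rw [mul_sub, mul_one, sub_eq_iff_eq_add]
  ext d e
  conv_lhs => rw [Matrix.of_apply, extKernel_eq_add_sum]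
  simp [Matrix.mul_apply, mul_comm, Matrix.one_apply, Pi.single_apply, add_comm]

theorem transfer_eq : C.transfer = Matrix.of fun d e => C.extKernel e (Sum.inr d) :=
  Matrix.inv_eq_left_inv C.of_extKernel_mul_one_sub_channelMatrix

theorem transfer_mul_one_sub_channelMatrix : C.transfer * (1 - C.channelMatrix) = 1 := by
  rw [transfer_eq, of_extKernel_mul_one_sub_channelMatrix]

theorem transfer_eq_one_add_mul : C.transfer = 1 + C.channelMatrix * C.transfer := by
  have h := mul_eq_one_comm.1 C.transfer_mul_one_sub_channelMatrix
  rwa [sub_mul, one_mul, sub_eq_iff_eq_add] at h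

theorem errorMatrix_eq (t : V) : C.errorMatrix t = C.transfer.submatrix id Subtype.val := by
  rw [transfer_eq]
  rfl

theorem messageMatrix_eq (t : V) : C.messageMatrix t = C.sourceMatrix * C.errorMatrix t := by
  have hrec : Matrix.of (fun i e => C.extKernel e (Sum.inl i)) * (1 - C.channelMatrix) =
      C.sourceMatrix := by
    rw [Matrix.mul_sub, Matrix.mul_one, sub_eq_iff_eq_add]
    ext i e
    conv_lhs => rw [Matrix.of_apply, extKernel_eq_add_sum]
    simp [Matrix.mul_apply, mul_comm, Pi.single_apply]
  have hsource : Matrix.of (fun i e => C.extKernel e (Sum.inl i)) =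
      C.sourceMatrix * C.transfer := by
    rw [← hrec, Matrix.mul_assoc, mul_eq_one_comm.1 C.transfer_mul_one_sub_channelMatrix,
      Matrix.mul_one]
  rw [errorMatrix_eq]
  exact congrArg (Matrix.submatrix · id Subtype.val) hsource

/-- The symbols carried by the channels when `v` gives the message symbols and the errors. -/
noncomputable def response (v : Fin n ⊕ E → F) : E → F :=
  ((v ∘ Sum.inl) ᵥ* C.sourceMatrix + v ∘ Sum.inr) ᵥ* C.transfer

theorem vecMul_decodingMatrix (v : Fin n ⊕ E → F) (t : V) :
    v ᵥ* C.decodingMatrix t = fun e : N.In t => C.response v e := by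
  have hsplit : v ᵥ* C.decodingMatrix t =
      (v ∘ Sum.inl) ᵥ* C.messageMatrix t + (v ∘ Sum.inr) ᵥ* C.errorMatrix t := by
    ext e
    simp [Matrix.vecMul, dotProduct, messageMatrix, errorMatrix]
  rw [hsplit, messageMatrix_eq, ← Matrix.vecMul_vecMul, ← Matrix.add_vecMul, errorMatrix_eq]
  rfl

theorem elim_response_vecMul_one_sub_transition (v : Fin n ⊕ E → F) :
    Sum.elim (v ∘ Sum.inl) (C.response v) ᵥ* (1 - C.transition) = v := by
  have hblocks : 1 - C.transition =
      Matrix.fromBlocks 1 (-C.sourceMatrix) 0 (1 - C.channelMatrix) := by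
    rw [transition, ← Matrix.fromBlocks_one, sub_eq_add_neg, Matrix.fromBlocks_neg,
      Matrix.fromBlocks_add]
    simp [sub_eq_add_neg]
  rw [hblocks, Matrix.vecMul_fromBlocks]
  ext (i | e) <;>
    simp [response, Matrix.vecMul_neg, transfer_mul_one_sub_channelMatrix]

/-- The rows of the decoding matrix at `t` that belong to the message channels and to the channels
in `p` are linearly independent: `t` can tell apart the messages combined with the errors in `p`. -/
def Resolves (t : V) (p : Finset E) : Prop :=
  LinearIndepOn F (C.decodingMatrix t).row (Finset.univ.disjSum p : Finset (Fin n ⊕ E))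

variable {C} {t : V} {p : Finset E}

theorem resolves_of_observable (ht : N.source ≠ t)
    (hC : Observable C.transition (Finset.univ.disjSum p : Finset (Fin n ⊕ E))
      {e | N.extHead n e = t}) : C.Resolves t p := by
  rw [Resolves, linearIndepOn_finset_iff]
  intro g hg
  let v : Fin n ⊕ E → F := fun d => if d ∈ Finset.univ.disjSum p then g d else 0
  let y : Fin n ⊕ E → F := Sum.elim (v ∘ Sum.inl) (C.response v)
  have hdefect : y ᵥ* (1 - C.transition) = v := C.elim_response_vecMul_one_sub_transition v
  have hresponse : ∀ e, N.head e = t → C.response v e = 0 := by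
    have hv : v ᵥ* C.decodingMatrix t = 0 := by
      rw [Matrix.vecMul_eq_sum, ← hg]
      simp [v, ite_smul, Finset.sum_ite_mem, Matrix.row]
    rw [vecMul_decodingMatrix] at hv
    exact fun e he => congrFun hv ⟨e, he⟩
  have hy : y = 0 := hC y (fun d hd => by rw [hdefect]; exact if_neg hd) fun
    | Sum.inl _, h => absurd h ht
    | Sum.inr e, h => hresponse e h
  intro d hd
  have hvd : v d = 0 := by rw [← hdefect, hy, Matrix.zero_vecMul, Pi.zero_apply]
  rwa [← show v d = g d from if_pos hd]

variable (C)

theorem messageSpace_eq_span (t : V) :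
    C.messageSpace t = Submodule.span F (Set.range (C.messageMatrix t).row) :=
  range_vecMulLinear _

theorem errorSpace_eq_span (t : V) (p : Finset E) :
    C.errorSpace t p = Submodule.span F ((C.errorMatrix t).row '' p) := by
  ext y
  rw [mem_errorSpace, Submodule.mem_span_image_finset_iff_exists_fun']
  constructor
  · rintro ⟨Z, hZ, rfl⟩
    refine ⟨Z, ?_⟩
    rw [Matrix.vecMul_eq_sum]
    exact Finset.sum_subset p.subset_univ fun e _ he => by rw [hZ e he, zero_smul]
  · rintro ⟨c, rfl⟩
    refine ⟨fun e => if e ∈ p then c e else 0, fun e he => if_neg he, ?_⟩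
    simp [Matrix.vecMul_eq_sum, ite_smul, Finset.sum_ite_mem, Matrix.row]

theorem errorSpace_mono {p q : Finset E} (h : p ⊆ q) : C.errorSpace t p ≤ C.errorSpace t q := by
  rw [errorSpace_eq_span, errorSpace_eq_span]
  exact Submodule.span_mono (Set.image_mono (Finset.coe_subset.2 h))

theorem errorSpace_union (p q : Finset E) :
    C.errorSpace t (p ∪ q) = C.errorSpace t p ⊔ C.errorSpace t q := by
  simp only [errorSpace_eq_span, Finset.coe_union, Set.image_union, Submodule.span_union]

theorem finrank_errorSpace_le_card (p : Finset E) :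
    Module.finrank F (C.errorSpace t p) ≤ p.card := by
  classical
  rw [errorSpace_eq_span, ← Finset.coe_image]
  exact (finrank_span_finset_le_card _).trans Finset.card_image_le

theorem row_errorMatrix_mem_errorSpace {p : Finset E} {e : E} (he : e ∈ p) :
    (C.errorMatrix t).row e ∈ C.errorSpace t p := by
  rw [errorSpace_eq_span]
  exact Submodule.subset_span ⟨e, he, rfl⟩

theorem row_errorMatrix_mem_errorSpace_of_isCut {Q : Finset E} (e : E)
    (he : e ∈ Q ∨ N.IsCut Q (N.head e) t) : (C.errorMatrix t).row e ∈ C.errorSpace t Q := by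
  induction e using (wellFounded_flip_of_acyclic N.adjacent_acyclic).induction with
  | _ e ih =>
  obtain heQ | hcut := he
  · exact C.row_errorMatrix_mem_errorSpace heQ
  have hrow : (C.errorMatrix t).row e = ∑ d, C.channelMatrix e d • (C.errorMatrix t).row d := by
    ext ⟨c, hc⟩
    have hec : e ≠ c := fun h => hcut (h ▸ hc ▸ .refl)
    simpa [errorMatrix_eq, Matrix.mul_apply, hec] using
      congrFun (congrFun C.transfer_eq_one_add_mul e) c
  rw [hrow]
  refine Submodule.sum_mem _ fun d _ => ?_
  by_cases hed : N.Adjacent e d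
  · exact Submodule.smul_mem _ _ (ih d hed (or_iff_not_imp_left.2 (hed ▸ hcut).head))
  · rw [show C.channelMatrix e d = 0 from dif_neg hed, zero_smul]
    exact Submodule.zero_mem _

theorem messageSpace_le_errorSpace_of_isCut {Q : Finset E} (hQ : N.IsCut Q N.source t) :
    C.messageSpace t ≤ C.errorSpace t Q := by
  rw [messageSpace_eq_span, Submodule.span_le]
  rintro _ ⟨i, rfl⟩
  have hrow : (C.messageMatrix t).row i = ∑ e, C.sourceMatrix i e • (C.errorMatrix t).row e := by
    ext c
    simp [messageMatrix_eq, Matrix.mul_apply]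
  rw [hrow]
  refine Submodule.sum_mem _ fun e _ => ?_
  by_cases he : N.tail e = N.source
  · exact Submodule.smul_mem _ _ (C.row_errorMatrix_mem_errorSpace_of_isCut e
      (or_iff_not_imp_left.2 (he.symm ▸ hQ).head))
  · rw [show C.sourceMatrix i e = 0 from dif_neg he, zero_smul]
    exact Submodule.zero_mem _

theorem messageSpace_le_errorSpace_univ (ht : N.source ≠ t) :
    C.messageSpace t ≤ C.errorSpace t Finset.univ := by
  obtain ⟨Q, hQ, -⟩ := N.exists_isCut_card_eq_capacity ht
  exact (C.messageSpace_le_errorSpace_of_isCut hQ).trans (C.errorSpace_mono Q.subset_univ)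

end NetworkCode

namespace MulticastNetwork

variable {V E F : Type*} [Fintype E] [DecidableEq V] [DecidableEq E] [Field F]
  {N : MulticastNetwork V E} {t : V} {p q : Finset E}

theorem Dominated.patternRank_le_card (h : N.Dominated F t p q) : N.patternRank F t p ≤ q.card :=
  Nat.sInf_le ⟨q, h, rfl⟩

theorem patternRank_le_card : N.patternRank F t p ≤ p.card :=
  Dominated.patternRank_le_card fun _ _ => le_rfl

theorem exists_dominated_card_eq_patternRank (N : MulticastNetwork V E) (F : Type*) [Field F]
    (t : V) (p : Finset E) : ∃ q, N.Dominated F t p q ∧ q.card = N.patternRank F t p :=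
  Nat.sInf_mem (s := {m | ∃ q, N.Dominated F t p q ∧ q.card = m}) ⟨_, p, fun _ _ => le_rfl, rfl⟩

theorem exists_dominated_mem_rankPatterns (N : MulticastNetwork V E) (F : Type*) [Field F]
    (t : V) (p : Finset E) :
    ∃ q, N.Dominated F t p q ∧ q ∈ N.rankPatterns F t (N.patternRank F t p) := by
  obtain ⟨q, hpq, hq⟩ := N.exists_dominated_card_eq_patternRank F t p
  obtain ⟨q', hqq', hq'⟩ := N.exists_dominated_card_eq_patternRank F t q
  have hle : N.patternRank F t p ≤ N.patternRank F t q :=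
    hq' ▸ Dominated.patternRank_le_card fun n C => (hpq n C).trans (hqq' n C)
  exact ⟨q, hpq, hq, (hq ▸ patternRank_le_card).antisymm hle⟩

theorem dominated_of_isCut (h : ∀ e ∈ p, e ∈ q ∨ N.IsCut q (N.head e) t) :
    N.Dominated F t p q := fun n C => by
  rw [C.errorSpace_eq_span t p, Submodule.span_le]
  rintro _ ⟨e, he, rfl⟩
  exact C.row_errorMatrix_mem_errorSpace_of_isCut e (h e he)

theorem patternRank_eq_card_of_linearIndepOn {n : ℕ} (C : NetworkCode N F n)
    (hp : LinearIndepOn F (C.errorMatrix t).row p) : N.patternRank F t p = p.card := by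
  refine patternRank_le_card.antisymm ?_
  obtain ⟨q, hpq, hq⟩ := N.exists_dominated_card_eq_patternRank F t p
  calc p.card = Module.finrank F (C.errorSpace t p) := by
        rw [C.errorSpace_eq_span, Set.image_eq_range]
        simpa using (finrank_span_eq_card hp).symm
    _ ≤ Module.finrank F (C.errorSpace t q) := Submodule.finrank_mono (hpq n C)
    _ ≤ q.card := C.finrank_errorSpace_le_card q
    _ = N.patternRank F t p := hq

theorem card_le_of_separates (hp : N.patternRank F t p = p.card) {n : ℕ}
    (hn : n + p.card ≤ N.capacity t) {Q : Finset (Fin n ⊕ E)}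
    (hQ : Separates (N.Feeds n) (Finset.univ.disjSum p : Finset (Fin n ⊕ E))
      {e | N.extHead n e = t} Q) : n + p.card ≤ Q.card := by
  by_cases hmessage : ∀ i, Sum.inl i ∈ Q
  · have hdom : N.Dominated F t p Q.toRight := dominated_of_isCut fun e he => by
      rw [Finset.mem_toRight, or_iff_not_imp_left]
      exact isCut_toRight_of_separates hQ (Finset.inr_mem_disjSum.2 he)
    have hleft : Q.toLeft = Finset.univ :=
      Finset.eq_univ_of_forall fun i => Finset.mem_toLeft.2 (hmessage i)
    rw [← Finset.card_toLeft_add_card_toRight (u := Q), hleft, Finset.card_fin, ← hp]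
    exact Nat.add_le_add_left hdom.patternRank_le_card n
  · push Not at hmessage
    obtain ⟨i, hi⟩ := hmessage
    have hcut : N.IsCut Q.toRight N.source t :=
      isCut_toRight_of_separates hQ (Finset.inl_mem_disjSum.2 (Finset.mem_univ i)) hi
    exact (hn.trans (capacity_le_card hcut)).trans Finset.card_toRight_le

end MulticastNetwork

namespace NetworkCode

variable {V E F : Type*} [Fintype E] [DecidableEq V] [DecidableEq E] [Field F]
  {N : MulticastNetwork V E} {n : ℕ} {C : NetworkCode N F n} {t : V} {p : Finset E}

theorem exists_forall_resolves (N : MulticastNetwork V E) (n : ℕ) (s : Finset (Σ _ : V, Finset E))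
    (hs : (s.card : ℕ∞) < ENat.card F)
    (hp : ∀ j ∈ s, N.source ≠ j.1 ∧ N.patternRank F j.1 j.2 = j.2.card ∧
      n + j.2.card ≤ N.capacity j.1) :
    ∃ C : NetworkCode N F n, ∀ j ∈ s, C.Resolves j.1 j.2 := by
  obtain ⟨K, hKfeeds, hK⟩ := exists_forall_observable (N.feeds_acyclic n) s hs
    (fun j => Finset.univ.disjSum j.2) (fun j => {e | N.extHead n e = j.1}) fun j hj Q hQ => by
      obtain ⟨-, hrank, hcap⟩ := hp j hj
      rw [Finset.card_disjSum, Finset.card_fin]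
      exact MulticastNetwork.card_le_of_separates hrank hcap hQ
  obtain ⟨C, rfl⟩ := exists_transition_eq K hKfeeds
  exact ⟨C, fun j hj => resolves_of_observable (hp j hj).1 (hK j hj)⟩

theorem Resolves.linearIndepOn_row_errorMatrix (h : C.Resolves t p) :
    LinearIndepOn F (C.errorMatrix t).row p :=
  LinearIndepOn.comp_of_image (f := Sum.inr) (s := (p : Set E))
    (LinearIndepOn.mono h (by rintro _ ⟨e, he, rfl⟩; exact Finset.inr_mem_disjSum.2 he))
    Sum.inr_injective.injOn

theorem Resolves.finrank_messageSpace_sup_errorSpace (h : C.Resolves t p) :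
    Module.finrank F ↥(C.messageSpace t ⊔ C.errorSpace t p) = n + p.card := by
  have hrows : C.messageSpace t ⊔ C.errorSpace t p = Submodule.span F
      ((C.decodingMatrix t).row '' (Finset.univ.disjSum p : Finset (Fin n ⊕ E))) := by
    have hcoe : ((Finset.univ.disjSum p : Finset (Fin n ⊕ E)) : Set (Fin n ⊕ E)) =
        Set.range Sum.inl ∪ Sum.inr '' p := by
      ext (i | e) <;> simp
    rw [messageSpace_eq_span, errorSpace_eq_span, ← Submodule.span_union, hcoe, Set.image_union,
      ← Set.range_comp, ← Set.image_comp]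
    rfl
  rw [hrows, Set.image_eq_range]
  simpa [Finset.card_disjSum] using finrank_span_eq_card h

end NetworkCode

theorem MulticastNetwork.exists_subset_mem_rankPatterns {V E F : Type*} [Fintype E]
    [DecidableEq V] [DecidableEq E] [Field F] {N : MulticastNetwork V E} {t : V} {p : Finset E}
    {δ : ℕ} (ht : N.source ≠ t) (hp : N.patternRank F t p = p.card) (hpδ : p.card ≤ δ)
    (hδ : δ ≤ N.capacity t) : ∃ q ∈ N.rankPatterns F t δ, p ⊆ q := by
  obtain ⟨m, rfl⟩ := Nat.exists_eq_add_of_le' hpδ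
  obtain ⟨C, hC⟩ := NetworkCode.exists_forall_resolves (F := F) N m {⟨t, p⟩}
    (by simp [ENat.one_lt_card]) (by simpa using ⟨ht, hp, hδ⟩)
  have hres : C.Resolves t p := hC _ (Finset.mem_singleton_self _)
  obtain ⟨b, -, hpb, hspan, hb⟩ := exists_linearIndepOn_extension
    hres.linearIndepOn_row_errorMatrix (Set.subset_univ _)
  lift b to Finset E using b.toFinite
  have hcard : m + p.card ≤ b.card :=
    calc m + p.card = Module.finrank F ↥(C.messageSpace t ⊔ C.errorSpace t p) :=
          hres.finrank_messageSpace_sup_errorSpace.symm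
      _ ≤ Module.finrank F (C.errorSpace t b) := Submodule.finrank_mono <| by
          have huniv : C.errorSpace t Finset.univ ≤ C.errorSpace t b := by
            rw [C.errorSpace_eq_span, C.errorSpace_eq_span, Finset.coe_univ]
            exact Submodule.span_le.2 hspan
          exact sup_le ((C.messageSpace_le_errorSpace_univ ht).trans huniv)
            (C.errorSpace_mono (Finset.coe_subset.1 hpb))
      _ ≤ b.card := C.finrank_errorSpace_le_card b
  obtain ⟨q, hpq, hqb, hq⟩ :=
    Finset.exists_subsuperset_card_eq (Finset.coe_subset.1 hpb) hpδ hcard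
  have hrank := patternRank_eq_card_of_linearIndepOn C (hb.mono (Finset.coe_subset.2 hqb))
  exact ⟨q, ⟨hq, hrank.trans hq⟩, hpq⟩

namespace NetworkCode

variable {V E F : Type*} [Fintype E] [DecidableEq V] [DecidableEq E] [Field F]
  {N : MulticastNetwork V E} {n : ℕ} {C : NetworkCode N F n} {t : V} {p q : Finset E}

/-- The messages whose received word at `t` can be cancelled by errors in `p`; a code detects the
errors in `p` when this space is trivial. -/
noncomputable def confusable (C : NetworkCode N F n) (t : V) (p : Finset E) :
    Submodule F (Fin n → F) :=
  (C.errorSpace t p).comap (C.messageMatrix t).vecMulLinear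

theorem map_confusable (C : NetworkCode N F n) (t : V) (p : Finset E) :
    (C.confusable t p).map (C.messageMatrix t).vecMulLinear =
      C.messageSpace t ⊓ C.errorSpace t p :=
  Submodule.map_comap_eq _ _

theorem finrank_messageSpace_eq_of_confusable_eq_bot (h : C.confusable t p = ⊥) :
    Module.finrank F (C.messageSpace t) = n := by
  have hker : LinearMap.ker (C.messageMatrix t).vecMulLinear = ⊥ :=
    le_bot_iff.1 (h ▸ LinearMap.ker_le_comap _)
  rw [messageSpace, LinearMap.finrank_range_of_inj (LinearMap.ker_eq_bot.1 hker),
    Module.finrank_fin_fun]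

theorem Resolves.vecMulLinear_messageMatrix_injective (h : C.Resolves t p) :
    Function.Injective (C.messageMatrix t).vecMulLinear := by
  refine Matrix.vecMul_injective_iff.2 ?_
  exact h.linearIndependent.comp
    (fun i => ⟨Sum.inl i, Finset.mem_coe.2 (Finset.inl_mem_disjSum.2 (Finset.mem_univ i))⟩)
    fun i j hij => Sum.inl_injective (Subtype.ext_iff.1 hij)

theorem Resolves.finrank_confusable_add_card_le (h : C.Resolves t p) (hpq : p ⊆ q) :
    Module.finrank F (C.confusable t q) + p.card ≤ q.card := by
  have hconfusable : Module.finrank F (C.confusable t q) =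
      Module.finrank F ↥(C.messageSpace t ⊓ C.errorSpace t q) := by
    rw [← map_confusable]
    exact (Submodule.equivMapOfInjective _ h.vecMulLinear_messageMatrix_injective _).finrank_eq
  have hsup : n + p.card ≤ Module.finrank F ↥(C.messageSpace t ⊔ C.errorSpace t q) :=
    h.finrank_messageSpace_sup_errorSpace.symm.trans_le
      (Submodule.finrank_mono (sup_le_sup_left (C.errorSpace_mono hpq) _))
  have hmessage : Module.finrank F (C.messageSpace t) ≤ n :=
    (LinearMap.finrank_range_le _).trans_eq (Module.finrank_fin_fun F)
  have hadd := Submodule.finrank_sup_add_finrank_inf_eq (C.messageSpace t) (C.errorSpace t q)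
  have herror := C.finrank_errorSpace_le_card (t := t) q
  omega

theorem Resolves.le_finrank_quotient_confusable (h : C.Resolves t p) (hpq : p ⊆ q) {m : ℕ}
    (hm : q.card + m ≤ n + p.card) : m ≤ Module.finrank F ((Fin n → F) ⧸ C.confusable t q) := by
  have hadd := (C.confusable t q).finrank_quotient_add_finrank
  rw [Module.finrank_fin_fun] at hadd
  have hle := h.finrank_confusable_add_card_le hpq
  omega

theorem confusable_eq_bot_of_forall_rankPatterns (ht : N.source ≠ t) {δ : ℕ}
    (hδ : δ ≤ N.capacity t) (h : ∀ q ∈ N.rankPatterns F t δ, C.confusable t q = ⊥)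
    (hp : N.patternRank F t p ≤ δ) : C.confusable t p = ⊥ := by
  obtain ⟨q, hpq, hq, hrank⟩ := N.exists_dominated_mem_rankPatterns F t p
  obtain ⟨r, hr, hqr⟩ := MulticastNetwork.exists_subset_mem_rankPatterns ht
    (hrank.trans hq.symm) (hq.trans_le hp) hδ
  exact le_bot_iff.1 (h r hr ▸ Submodule.comap_mono ((hpq n C).trans (C.errorSpace_mono hqr)))

/-- A minimum cut splits as `p ∪ (Q \ p)` and `Φ(t) ≤ Δ(t, Q)`; since `|Q \ p| < n`, the error
space of `p` alone must meet `Φ(t)`. -/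
theorem exists_card_add_eq_and_finrank_pos (ht : N.source ≠ t) (hn : 1 ≤ n)
    (hnC : n ≤ N.capacity t) (hreg : Module.finrank F (C.messageSpace t) = n) :
    ∃ p : Finset E, p.card + n = N.capacity t + 1 ∧
      0 < Module.finrank F ↥(C.errorSpace t p ⊓ C.messageSpace t) := by
  obtain ⟨Q, hQ, hQcard⟩ := N.exists_isCut_card_eq_capacity ht
  obtain ⟨p, hpQ, hp⟩ := Finset.exists_subset_card_eq (s := Q) (n := N.capacity t - n + 1)
    (by omega)
  refine ⟨p, by omega, ?_⟩
  have hsup : C.errorSpace t p ⊔ C.messageSpace t ≤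
      C.errorSpace t p ⊔ C.errorSpace t (Q \ p) := by
    rw [← C.errorSpace_union, Finset.union_sdiff_of_subset hpQ]
    exact sup_le (C.errorSpace_mono hpQ) (C.messageSpace_le_errorSpace_of_isCut hQ)
  have hle := (Submodule.finrank_mono hsup).trans
    (Submodule.finrank_add_le_finrank_add_finrank _ _)
  have hadd := Submodule.finrank_sup_add_finrank_inf_eq (C.errorSpace t p) (C.messageSpace t)
  have hrest := C.finrank_errorSpace_le_card (t := t) (Q \ p)
  have hcard := Finset.card_sdiff_add_card_eq_card hpQ
  omega

theorem minDist_add_eq_of_confusable_eq_bot (ht : N.source ≠ t) (hn : 1 ≤ n)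
    (hnC : n ≤ N.capacity t)
    (h : ∀ p, N.patternRank F t p ≤ N.capacity t - n → C.confusable t p = ⊥) :
    C.minDist t + n = N.capacity t + 1 := by
  have hreg : Module.finrank F (C.messageSpace t) = n :=
    finrank_messageSpace_eq_of_confusable_eq_bot
      (h ∅ (MulticastNetwork.patternRank_le_card.trans (Nat.zero_le _)))
  obtain ⟨p, hp, hpos⟩ := exists_card_add_eq_and_finrank_pos ht hn hnC hreg
  have hminDist : C.minDist t ≤ N.patternRank F t p := Nat.sInf_le ⟨p, hpos, rfl⟩
  have hupper : C.minDist t ≤ p.card := hminDist.trans MulticastNetwork.patternRank_le_card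
  have hlower : N.capacity t - n + 1 ≤ C.minDist t := by
    refine le_csInf ⟨_, p, hpos, rfl⟩ ?_
    rintro _ ⟨q, hq, rfl⟩
    by_contra! hlt
    rw [inf_comm, ← map_confusable, h q (Nat.le_of_lt_succ hlt), Submodule.map_bot,
      finrank_bot] at hq
    exact hq.false
  omega

theorem isMDS_of_confusable_eq_bot (hn : 1 ≤ n) (hcap : ∀ t ∈ N.sinks, n ≤ N.capacity t)
    (h : ∀ t ∈ N.sinks, ∀ p ∈ N.rankPatterns F t (N.capacity t - n), C.confusable t p = ⊥) :
    C.IsMDS := by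
  have hsource : ∀ t ∈ N.sinks, N.source ≠ t := fun t ht hst => N.source_notMem_sinks (hst ▸ ht)
  have hbot : ∀ t ∈ N.sinks, ∀ p, N.patternRank F t p ≤ N.capacity t - n →
      C.confusable t p = ⊥ := fun t ht p =>
    confusable_eq_bot_of_forall_rankPatterns (hsource t ht) (Nat.sub_le _ _) (h t ht)
  refine ⟨fun t ht => finrank_messageSpace_eq_of_confusable_eq_bot
    (hbot t ht ∅ (MulticastNetwork.patternRank_le_card.trans (Nat.zero_le _))), fun t ht => ?_⟩
  have hdist := minDist_add_eq_of_confusable_eq_bot (hsource t ht) hn (hcap t ht) (hbot t ht)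
  omega

/-- The code obtained by multiplying the message by `T` before it enters the network; only the
local encoding kernel at the source changes. -/
def precode {m : ℕ} (C : NetworkCode N F n) (T : Matrix (Fin m) (Fin n) F) :
    NetworkCode N F m where
  sourceKernel := T * C.sourceKernel
  kernel := C.kernel

theorem errorMatrix_precode {m : ℕ} (C : NetworkCode N F n) (T : Matrix (Fin m) (Fin n) F)
    (t : V) : (C.precode T).errorMatrix t = C.errorMatrix t := by
  rw [errorMatrix_eq, errorMatrix_eq]
  rfl

theorem messageMatrix_precode {m : ℕ} (C : NetworkCode N F n) (T : Matrix (Fin m) (Fin n) F)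
    (t : V) : (C.precode T).messageMatrix t = T * C.messageMatrix t := by
  have hsource : (C.precode T).sourceMatrix = T * C.sourceMatrix := by
    ext i e
    by_cases he : N.tail e = N.source <;>
      simp [sourceMatrix, precode, Matrix.mul_apply, he]
  rw [messageMatrix_eq, messageMatrix_eq, errorMatrix_precode, hsource, Matrix.mul_assoc]

theorem confusable_precode {m : ℕ} (C : NetworkCode N F n) (T : Matrix (Fin m) (Fin n) F)
    (t : V) (p : Finset E) :
    (C.precode T).confusable t p = (C.confusable t p).comap T.vecMulLinear := by
  ext X
  simp [confusable, errorSpace, errorMatrix_precode, messageMatrix_precode,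
    Matrix.vecMul_vecMul]

theorem confusable_precode_eq_bot {m : ℕ} {T : Matrix (Fin m) (Fin n) F}
    (hT : LinearIndependent F ((C.confusable t p).mkQ ∘ T.row)) :
    (C.precode T).confusable t p = ⊥ := by
  rw [confusable_precode, Submodule.eq_bot_iff]
  intro X hX
  refine funext (Fintype.linearIndependent_iff.1 hT X ?_)
  have hmk : (C.confusable t p).mkQ (X ᵥ* T) = 0 := (Submodule.Quotient.mk_eq_zero _).2 hX
  rwa [Matrix.vecMul_eq_sum, map_sum] at hmk

end NetworkCode

/-- The pairs `(t, p)` of a sink and an independent error pattern of size `C_t - n`; these are the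
error patterns an `n`-dimensional code has to detect in order to be MDS. -/
noncomputable def MulticastNetwork.criticalPatterns {V E : Type*} [Fintype E] [DecidableEq V]
    [DecidableEq E] (N : MulticastNetwork V E) (F : Type*) [Field F] (n : ℕ) :
    Finset (Σ _ : V, Finset E) :=
  N.sinks.sigma fun t => (N.rankPatterns F t (N.capacity t - n)).toFinite.toFinset

namespace MulticastNetwork

variable {V E F : Type*} [Fintype E] [DecidableEq V] [DecidableEq E] [Field F]
  {N : MulticastNetwork V E} {n ω : ℕ} {t : V} {p : Finset E}

theorem mk_mem_criticalPatterns :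
    ⟨t, p⟩ ∈ N.criticalPatterns F n ↔
      t ∈ N.sinks ∧ p ∈ N.rankPatterns F t (N.capacity t - n) := by
  simp [criticalPatterns]

theorem card_criticalPatterns (N : MulticastNetwork V E) (F : Type*) [Field F] (n : ℕ) :
    (N.criticalPatterns F n).card =
      ∑ t ∈ N.sinks, (N.rankPatterns F t (N.capacity t - n)).ncard := by
  simp_rw [criticalPatterns, Finset.card_sigma, ← Set.ncard_eq_toFinset_card]

theorem card_criticalPatterns_le_sup (hcap : ∀ t ∈ N.sinks, ω ≤ N.capacity t)
    (hn : n ∈ Finset.Icc 1 ω) :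
    (N.criticalPatterns F n).card ≤ (Finset.range ω).sup fun i =>
      ∑ t ∈ N.sinks, (N.rankPatterns F t (N.capacity t - ω + i)).ncard := by
  rw [Finset.mem_Icc] at hn
  calc (N.criticalPatterns F n).card
      = ∑ t ∈ N.sinks, (N.rankPatterns F t (N.capacity t - ω + (ω - n))).ncard := by
        rw [card_criticalPatterns]
        refine Finset.sum_congr rfl fun t ht => ?_
        rw [tsub_add_tsub_cancel (hcap t ht) hn.2]
    _ ≤ _ := Finset.le_sup (f := fun i =>
        ∑ t ∈ N.sinks, (N.rankPatterns F t (N.capacity t - ω + i)).ncard)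
        (Finset.mem_range.2 (by omega))

theorem patternRank_eq_card_of_subset {q : Finset E} (hpq : p ⊆ q)
    (hq : N.patternRank F t q = q.card) : N.patternRank F t p = p.card := by
  refine patternRank_le_card.antisymm ?_
  obtain ⟨r, hpr, hr⟩ := N.exists_dominated_card_eq_patternRank F t p
  have hdom : N.Dominated F t q (r ∪ q \ p) := fun n C => by
    rw [← Finset.union_sdiff_of_subset hpq, C.errorSpace_union,
      Finset.union_sdiff_of_subset hpq, C.errorSpace_union]
    exact sup_le_sup_right (hpr n C) _
  have hle := hdom.patternRank_le_card.trans (Finset.card_union_le r (q \ p))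
  have hcard := Finset.card_sdiff_add_card_eq_card hpq
  omega

theorem exists_subset_mk_mem_criticalPatterns (hcap : ∀ t ∈ N.sinks, ω ≤ N.capacity t)
    (hn : n ≤ ω) {q : Finset E} (hq : ⟨t, q⟩ ∈ N.criticalPatterns F n) :
    ∃ p ⊆ q, ⟨t, p⟩ ∈ N.criticalPatterns F ω ∧ q.card + n = ω + p.card := by
  obtain ⟨ht, hcard, hrank⟩ := mk_mem_criticalPatterns.1 hq
  have hω := hcap t ht
  obtain ⟨p, hpq, hp⟩ := Finset.exists_subset_card_eq (s := q) (n := N.capacity t - ω) (by omega)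
  have hprank := patternRank_eq_card_of_subset hpq (hrank.trans hcard.symm)
  exact ⟨p, hpq, mk_mem_criticalPatterns.2 ⟨ht, hp, hprank.trans hp⟩, by omega⟩

end MulticastNetwork

namespace NetworkCode

variable {V E F : Type*} [Fintype E] [DecidableEq V] [DecidableEq E] [Field F]
  {N : MulticastNetwork V E} {n ω : ℕ}

theorem exists_forall_criticalPatterns_resolves (hcap : ∀ t ∈ N.sinks, n ≤ N.capacity t)
    (hF : ((N.criticalPatterns F n).card : ℕ∞) < ENat.card F) :
    ∃ C : NetworkCode N F n, ∀ j ∈ N.criticalPatterns F n, C.Resolves j.1 j.2 := by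
  refine exists_forall_resolves N n _ hF ?_
  rintro ⟨t, p⟩ hj
  obtain ⟨ht, hcard, hrank⟩ := MulticastNetwork.mk_mem_criticalPatterns.1 hj
  refine ⟨fun hst => N.source_notMem_sinks (hst ▸ ht), hrank.trans hcard.symm, ?_⟩
  exact (Nat.add_le_add_left hcard.le n).trans (Nat.add_sub_cancel' (hcap t ht)).le

theorem exists_isMDS_precode {C : NetworkCode N F ω} (hcap : ∀ t ∈ N.sinks, ω ≤ N.capacity t)
    (hC : ∀ j ∈ N.criticalPatterns F ω, C.Resolves j.1 j.2) (hn : n ∈ Finset.Icc 1 ω)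
    (hF : ((N.criticalPatterns F n).card : ℕ∞) < ENat.card F) :
    ∃ T : Matrix (Fin n) (Fin ω) F, (C.precode T).IsMDS := by
  rw [Finset.mem_Icc] at hn
  obtain ⟨T, hT⟩ := exists_forall_linearIndependent_mkQ _ hF
    (fun j => C.confusable j.1 j.2) n fun j hj => by
      obtain ⟨p, hpq, hp, hcard⟩ :=
        MulticastNetwork.exists_subset_mk_mem_criticalPatterns hcap hn.2 hj
      exact (hC _ hp).le_finrank_quotient_confusable hpq hcard.le
  refine ⟨Matrix.of T, isMDS_of_confusable_eq_bot hn.1 (fun t ht => hn.2.trans (hcap t ht)) ?_⟩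
  exact fun t ht p hp => confusable_precode_eq_bot
    (hT ⟨t, p⟩ (MulticastNetwork.mk_mem_criticalPatterns.2 ⟨ht, hp⟩))

end NetworkCode

theorem mainTheorem2_general {V E F : Type*} [Fintype E] [DecidableEq V] [DecidableEq E] [Field F]
    (N : MulticastNetwork V E) (ω : ℕ) (hω : 1 ≤ ω) (hωC : ∀ t ∈ N.sinks, ω ≤ N.capacity t)
    (hF : (((Finset.range ω).sup fun i =>
        ∑ t ∈ N.sinks, (N.rankPatterns F t (N.capacity t - ω + i)).ncard : ℕ) : ℕ∞) <
      ENat.card F) :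
    ∃ (C : NetworkCode N F ω) (T : (n : ℕ) → Matrix (Fin n) (Fin ω) F),
      ∀ n ∈ Finset.Icc 1 ω, (C.precode (T n)).IsMDS := by
  have hcard : ∀ n ∈ Finset.Icc 1 ω, ((N.criticalPatterns F n).card : ℕ∞) < ENat.card F :=
    fun n hn => hF.trans_le'
      (Nat.cast_le.2 (MulticastNetwork.card_criticalPatterns_le_sup hωC hn))
  obtain ⟨C, hC⟩ := NetworkCode.exists_forall_criticalPatterns_resolves hωC
    (hcard ω (Finset.right_mem_Icc.2 hω))
  have hprecode : ∀ n ∈ Finset.Icc 1 ω, ∃ T : Matrix (Fin n) (Fin ω) F, (C.precode T).IsMDS :=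
    fun n hn => NetworkCode.exists_isMDS_precode hωC hC hn (hcard n hn)
  choose! T hT using hprecode
  exact ⟨C, T, hT⟩

theorem mainTheorem2 {V E F : Type*} [Finite V] [Fintype E] [DecidableEq V] [DecidableEq E]
    [Field F] [Fintype F] (N : MulticastNetwork V E) (ω : ℕ) (hω : 1 ≤ ω)
    (hωC : ∀ t ∈ N.sinks, ω ≤ N.capacity t)
    (hF : ((Finset.range ω).sup fun i =>
        ∑ t ∈ N.sinks, (N.rankPatterns F t (N.capacity t - ω + i)).ncard) < Fintype.card F) :
    ∃ C : (n : ℕ) → NetworkCode N F n,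
      (∀ n ∈ Finset.Icc 1 ω, (C n).IsMDS) ∧
      ∀ m ∈ Finset.Icc 1 ω, ∀ n ∈ Finset.Icc 1 ω, ∀ i ∈ N.internalNodes,
        (C m).kernel i = (C n).kernel i := by
  obtain ⟨C, T, hT⟩ := mainTheorem2_general (F := F) N ω hω hωC (by simpa using hF)
  exact ⟨fun n => C.precode (T n), hT, fun _ _ _ _ _ _ => rfl⟩
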